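/- A word is a finite string of letters from an alphabet, and a subword of a word $w$ is a string of consecutive letters of $w$. A word $w$ contains a pattern $P$ (a string of letters) if one can substitute a nonempty word for each letter occurring in $P$ (the same word at each occurrence of the same letter; different letters may receive equal words) so that the resulting word is a subword of $w$. The Zimin words are the patterns $Z_1 = x_1$ and $Z_{n+1} = Z_n x_{n+1} Z_n$, where $x_1, x_2, \dots$ are distinct letters; thus $Z_3 = abacaba$. For a positive integer $q$, let $f(3,q)$ be the smallest integer $N$ such that every word of length $N$ over an alphabet of size $q$ contains $Z_3$. Theorem. For every $q \ge 1$ the number $f(3,q)$ exists, and $f(3,q) = \Theta(2^q\, q!)$ as $q \to \infty$. More precisely, $$f(3,q) < 3e^{1/2}\, 2^q\, q! \quad \text{for all integers } q > 3,$$ and $$f(3,q) > \tfrac{3}{4}\, 2^q\, q! + 2q - 4 \quad \text{for all integers } q \ge 5.$$ -/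

import Mathlib

namespace ZiminWord

/-- The word `w` contains the pattern `P`: one can substitute a nonempty word for each letter
occurring in `P` so that the resulting word is a string of consecutive letters of `w`. -/
def Contains {α β : Type*} (w : List α) (P : List β) : Prop :=
  ∃ σ : β → List α, (∀ b ∈ P, σ b ≠ []) ∧ P.flatMap σ <:+: w

/-- The Zimin words, with letters `0, 1, 2, …`: `Z_1 = 0`, `Z_2 = 010`, `Z_3 = 0102010`, and
`Z_{n+1} = Z_n x Z_n` with `x` a new letter (`Z_0` is the empty word). -/
def zimin : ℕ → List ℕ
  | 0 => []
  | n + 1 => zimin n ++ n :: zimin n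

/-- The lengths `N` such that every word of length `N` over an alphabet of size `q`
contains `Z_n`. -/
def forcingLengths (n q : ℕ) : Set ℕ :=
  {N | ∀ w : List (Fin q), w.length = N → Contains w (zimin n)}

/-- `f(n, q)`: the smallest `N` such that every word of length `N` over an alphabet of size `q`
contains `Z_n`. -/
noncomputable def f (n q : ℕ) : ℕ := sInf (forcingLengths n q)

end ZiminWord

/-! In an occurrence of `Z_3`, the word substituted for the first letter may be shrunk to one
letter. So a word avoids `Z_3` iff no factor `aYa` with `Y` nonempty occurs twice with a nonempty
gap between the copies.

Upper bound. In a word avoiding `Z_3`, charge each position `x` to the first minimal `aYa` at or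
after `x`. Except for the `O(q^2)` positions charged to a cube `aaa` or to nothing, `a` is not in
`Y`, and `Y` consists of runs of length at most two with distinct letters. A given `aYa` then starts
at no more than two positions (`card_part_le`): copies overlap at most in an end letter, so the
outer two of three would give `Z_3`. If `Y` has `j` letters, each start is charged by at most
`2(q-j)` positions, because the stretch before it is `aba`-free and, its last position aside, avoids
the letters of `aYa`. Summing `4(q-j)` over all choices of `a` and `Y` gives a partial sum of a
series with total `3e^{1/2} 2^q q!`.

Lower bound. Take as edges of a digraph the sequences of `q-1` runs of length one or two with
distinct letters, and as vertices those of `q-2` runs. Following an Eulerian circuit writes a word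
in which each edge occurs once. A repeated `aYa` containing `q-1` complete runs is thus impossible.
The other danger is a return to `a` after only `q-1` runs, where the length of the first run is not
visible in `aYa`. It is avoided by a circuit in which at most one of two edges differing only in
that length is followed by a return (`exists_transitive_transition`). Runs have average length `3/2`
over the circuit, hence the constant `3/4`. -/

namespace ZiminWord

/-! ### The pattern `Z_3` as a repeated factor -/

/-- `XYX` can be cut down to the stretch from the first letter of one `X` to the first letter of the
other, so a one-letter `X` suffices. The `2` in `p + d + 2 ≤ p'` keeps the middle word nonempty. -/
theorem contains_zimin_three_iff {α : Type*} (W : ℕ → α) (N : ℕ) :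
    Contains ((List.range N).map W) (zimin 3) ↔
      ∃ p p' d, 2 ≤ d ∧ p + d + 2 ≤ p' ∧ p' + d < N ∧ W p = W (p + d) ∧
        ∀ t ≤ d, W (p + t) = W (p' + t) := by
  have hz : zimin 3 = [0, 1, 0, 2, 0, 1, 0] := rfl
  rw [hz]
  constructor
  · rintro ⟨σ, hσ, s, t, h⟩
    simp only [List.flatMap_cons, List.flatMap_nil, List.append_nil] at h
    obtain ⟨hX, hY, hZ⟩ : σ 0 ≠ [] ∧ σ 1 ≠ [] ∧ σ 2 ≠ [] :=
      ⟨hσ 0 (by simp), hσ 1 (by simp), hσ 2 (by simp)⟩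
    generalize σ 0 = X at *
    generalize σ 1 = Y at *
    generalize σ 2 = Z at *
    have lX := List.length_pos_iff.2 hX
    have lY := List.length_pos_iff.2 hY
    have lZ := List.length_pos_iff.2 hZ
    have hN : s.length + (4 * X.length + 2 * Y.length + Z.length) + t.length = N := by
      have := congrArg List.length h
      simp at this
      omega
    have key : ∀ (a u b : List α), a ++ u ++ b = (List.range N).map W →
        ∀ j, j < u.length → u[j]? = some (W (a.length + j)) := by
      intro a u b hab j hj
      have hl := congrArg List.length hab
      simp only [List.length_append, List.length_map, List.length_range] at hl
      have h1 := congrArg (fun l => l[a.length + j]?) hab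
      rw [List.getElem?_append_left (by simp; omega), List.getElem?_append_right (by omega),
        List.getElem?_map, List.getElem?_range (by omega)] at h1
      simpa using h1
    have k1 := key s (X ++ Y ++ X) (Z ++ X ++ Y ++ X ++ t) (by simpa using h)
    have k2 := key (s ++ X ++ Y ++ X ++ Z) (X ++ Y ++ X) t (by simpa using h)
    simp only [List.length_append] at k1 k2
    refine ⟨s.length, s.length + X.length + Y.length + X.length + Z.length,
      X.length + Y.length, by omega, by omega, by omega, ?_, ?_⟩
    · have h1 := k1 0 (by omega)
      have h2 := k1 (X.length + Y.length) (by omega)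
      rw [List.append_assoc, List.getElem?_append_left lX] at h1
      rw [List.getElem?_append_right (by simp)] at h2
      simp only [List.length_append, Nat.sub_self] at h2
      rw [h1] at h2
      simpa using h2
    · intro j hj
      have h1 := k1 j (by omega)
      have h2 := k2 j (by omega)
      rw [h1] at h2
      simpa using h2
  · rintro ⟨p, p', d, hd, hp, hN, hW, hWW⟩
    obtain ⟨d, rfl⟩ : ∃ d', d = d' + 2 := ⟨d - 2, by omega⟩
    obtain ⟨z, rfl⟩ : ∃ z, p' = p + (d + 2) + 2 + z := ⟨_, (Nat.add_sub_of_le hp).symm⟩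
    refine ⟨fun b => if b = 0 then [W p] else if b = 1 then (List.range' (p + 1) (d + 1)).map W
      else (List.range' (p + d + 3) (z + 1)).map W, ?_, ?_⟩
    · intro b hb
      dsimp only
      split_ifs <;> simp
    · refine ⟨(List.range' 0 p).map W,
        (List.range' (p + (2 * d + z + 7)) (N - (p + (2 * d + z + 7)))).map W, ?_⟩
      have e1 : [W p] = (List.range' (p + d + 2) 1).map W := by simpa [add_assoc] using hW
      have e2 : [W p] = (List.range' (p + d + 4 + z) 1).map W := by
        have := hWW 0 (by omega)
        simp only [add_zero] at this
        simp [this]; congr 1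
      have e3 : [W p] = (List.range' (p + 2 * d + 6 + z) 1).map W := by
        have := hWW (d + 2) (by omega)
        rw [hW, this]
        simp; congr 1; omega
      have e4 : (List.range' (p + 1) (d + 1)).map W =
          (List.range' (p + d + 5 + z) (d + 1)).map W := by
        apply List.ext_getElem (by simp)
        intro i h1 h2
        simp at h1
        have := hWW (1 + i) (by omega)
        simp only [List.getElem_map, List.getElem_range', one_mul]
        rw [← add_assoc] at this
        rw [this]; congr 1; omega
      have hr : List.range N = List.range' 0 N := List.range_eq_range'
      have app : ∀ a m b n, b = a + m → (List.range' a m).map W ++ (List.range' b n).map W =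
          (List.range' a (m + n)).map W := by
        rintro a m b n rfl
        rw [← List.map_append, List.range'_append_1]
      simp only [List.flatMap_cons, List.flatMap_nil, List.append_nil, if_true, one_ne_zero,
        if_false, OfNat.ofNat_ne_zero, OfNat.ofNat_ne_one]
      have e0 : [W p] = (List.range' p 1).map W := by simp
      have : [W p] ++ ((List.range' (p + 1) (d + 1)).map W ++ ([W p] ++
          ((List.range' (p + d + 3) (z + 1)).map W ++ ([W p] ++
          ((List.range' (p + 1) (d + 1)).map W ++ [W p]))))) =
          (List.range' p (2 * d + z + 7)).map W := by
        calc _ = (List.range' p 1).map W ++ ((List.range' (p + 1) (d + 1)).map W ++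
            ((List.range' (p + d + 2) 1).map W ++
            ((List.range' (p + d + 3) (z + 1)).map W ++ ((List.range' (p + d + 4 + z) 1).map W ++
            ((List.range' (p + d + 5 + z) (d + 1)).map W ++
              (List.range' (p + 2 * d + 6 + z) 1).map W))))) := by
              rw [← e0, ← e1, ← e2, ← e3, ← e4]
          _ = _ := by
              rw [app, app, app, app, app, app] <;> try omega
              congr 2; omega
      rw [this, hr, app _ _ _ _ (by omega), app _ _ _ _ (by omega)]
      congr 2; omega

/-! ### Words avoiding `aba` -/

/-- No letter occurs at two positions at distance at least two: the words avoiding `aba`. -/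
def SpreadFree {α : Type*} : List α → Prop
  | [] => True
  | x :: l => x ∉ l.tail ∧ SpreadFree l

theorem spreadFree_map_range' {α : Type*} (W : ℕ → α) (i n : ℕ)
    (h : ∀ a b, i ≤ a → a + 2 ≤ b → b < i + n → W a ≠ W b) :
    SpreadFree ((List.range' i n).map W) := by
  induction n generalizing i with
  | zero => simp [SpreadFree]
  | succ n ih =>
    rw [List.range'_succ, List.map_cons]
    refine ⟨fun hm => ?_, ih _ fun a b h1 h2 h3 => h a b (by omega) h2 (by omega)⟩
    rcases n with _ | n
    · simp at hm
    · rw [List.range'_succ, List.map_cons, List.tail_cons, List.mem_map] at hm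
      obtain ⟨b, hb, hb'⟩ := hm
      rw [List.mem_range'_1] at hb
      exact h i b le_rfl (by omega) (by omega) hb'.symm

section Words

variable {α : Type*} [DecidableEq α]

theorem SpreadFree.length_le : ∀ l : List α, SpreadFree l → l.length ≤ 2 * l.toFinset.card
  | [], _ => by simp
  | [x], _ => by simp
  | x :: y :: l, h => by
    obtain ⟨hx, hy⟩ := h
    by_cases hxy : x = y
    · subst hxy
      have ih := SpreadFree.length_le l hy.2
      have hx' : x ∉ l.toFinset := by simpa using hx
      simp only [List.toFinset_cons, Finset.insert_idem, Finset.card_insert_of_notMem hx',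
        List.length_cons]
      omega
    · have ih := SpreadFree.length_le (y :: l) hy
      have hx' : x ∉ (y :: l).toFinset := by simpa [hxy] using hx
      rw [List.toFinset_cons, Finset.card_insert_of_notMem hx', List.length_cons]
      omega

/-- The words over `A` made of `k` runs of length one or two, with distinct letters. -/
def runWords : ℕ → Finset α → Finset (List α)
  | 0, _ => {[]}
  | k + 1, A => A.biUnion fun x =>
      (runWords k (A.erase x)).image (x :: ·) ∪ (runWords k (A.erase x)).image (x :: x :: ·)

theorem card_runWords_le (k : ℕ) (A : Finset α) :
    (runWords k A).card ≤ 2 ^ k * A.card.descFactorial k := by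
  induction k generalizing A with
  | zero => simp [runWords]
  | succ k ih =>
    rw [runWords]
    calc _ ≤ ∑ x ∈ A, 2 * (2 ^ k * (A.card - 1).descFactorial k) := by
          refine Finset.card_biUnion_le.trans (Finset.sum_le_sum fun x hx => ?_)
          have h := ih (A.erase x)
          rw [Finset.card_erase_of_mem hx] at h
          refine (Finset.card_union_le _ _).trans ?_
          have h1 := Finset.card_image_le (s := runWords k (A.erase x)) (f := (x :: ·))
          have h2 := Finset.card_image_le (s := runWords k (A.erase x)) (f := (x :: x :: ·))
          omega
      _ = _ := by
          rw [Finset.sum_const, smul_eq_mul]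
          rcases hA : A.card with _ | n
          · simp
          · rw [Nat.succ_descFactorial_succ, Nat.add_sub_cancel]; ring

theorem SpreadFree.mem_runWords : ∀ (l : List α) (A : Finset α), SpreadFree l → l.toFinset ⊆ A →
    l ∈ runWords l.toFinset.card A
  | [], A, _, _ => by simp [runWords]
  | [x], A, _, hA => by
    have : x ∈ A := by simpa using hA
    simp [runWords, this]
  | x :: y :: l, A, h, hA => by
    obtain ⟨hx, hy⟩ := h
    by_cases hxy : x = y
    · subst hxy
      have hx' : x ∉ l.toFinset := by simpa using hx
      have ih := SpreadFree.mem_runWords l (A.erase x) hy.2 fun z hz => by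
        refine Finset.mem_erase.2 ⟨fun h => hx' (h ▸ hz), hA (by simp_all)⟩
      simp only [List.toFinset_cons, Finset.insert_idem, Finset.card_insert_of_notMem hx', runWords,
        Finset.mem_biUnion]
      exact ⟨x, hA (by simp), Finset.mem_union_right _ (Finset.mem_image_of_mem _ ih)⟩
    · have hx' : x ∉ (y :: l).toFinset := by simpa [hxy] using hx
      have ih := SpreadFree.mem_runWords (y :: l) (A.erase x) hy fun z hz => by
        refine Finset.mem_erase.2 ⟨fun h => hx' (h ▸ hz), hA ?_⟩
        rw [List.toFinset_cons]
        exact Finset.mem_insert_of_mem hz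
      rw [List.toFinset_cons, Finset.card_insert_of_notMem hx', runWords, Finset.mem_biUnion]
      exact ⟨x, hA (by simp), Finset.mem_union_left _ (Finset.mem_image_of_mem _ ih)⟩

theorem toFinset_map_range' (W : ℕ → α) (i n : ℕ) :
    ((List.range' i n).map W).toFinset = (Finset.Ico i (i + n)).image W := by
  ext z
  simp [List.mem_range'_1]

theorem length_le_of_spread {W : ℕ → α} {i n : ℕ}
    (h : ∀ a b, i ≤ a → a + 2 ≤ b → b < i + n → W a ≠ W b) :
    n ≤ 2 * ((Finset.Ico i (i + n)).image W).card := by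
  have := (spreadFree_map_range' W i n h).length_le
  rwa [toFinset_map_range', List.length_map, List.length_range'] at this

end Words

/-! ### Upper bound: charging positions to minimal occurrences of `aba` -/

/-- `[s, e]` is the first minimal occurrence of the pattern `aba` in `W` restricted to `[x, N)`. -/
structure IsNext {α : Type*} (W : ℕ → α) (N x s e : ℕ) : Prop where
  le : x ≤ s
  add_two_le : s + 2 ≤ e
  lt : e < N
  eq : W s = W e
  free_left : ∀ a b, x ≤ a → a + 2 ≤ b → b < e → W a ≠ W b
  free_right : ∀ a b, s < a → a + 2 ≤ b → b ≤ e → W a ≠ W b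

theorem exists_isNext {α : Type*} {W : ℕ → α} {N x : ℕ}
    (h : ∃ a b, x ≤ a ∧ a + 2 ≤ b ∧ b < N ∧ W a = W b) : ∃ s e, IsNext W N x s e := by
  classical
  have h' : ∃ e, ∃ s, x ≤ s ∧ s + 2 ≤ e ∧ e < N ∧ W s = W e := by
    obtain ⟨a, b, h⟩ := h
    exact ⟨b, a, h⟩
  set e := Nat.find h' with he
  -- The end `e` is least possible; for this `e` the start is taken greatest.
  obtain ⟨s0, hs0⟩ := Nat.find_spec h'
  rw [← he] at hs0
  let P : ℕ → Prop := fun s => x ≤ s ∧ s + 2 ≤ e ∧ e < N ∧ W s = W e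
  have hP : P (Nat.findGreatest P e) := Nat.findGreatest_spec (m := s0) (by omega) hs0
  have hl : ∀ a b, x ≤ a → a + 2 ≤ b → b < e → W a ≠ W b := fun a b h1 h2 h3 h4 =>
    Nat.find_min h' h3 ⟨a, h1, h2, h3.trans hs0.2.2.1, h4⟩
  refine ⟨Nat.findGreatest P e, e, hP.1, hP.2.1, hP.2.2.1, hP.2.2.2, hl, ?_⟩
  intro a b h1 h2 h3 h4
  rcases h3.lt_or_eq with h3 | rfl
  · exact hl a b (hP.1.trans h1.le) h2 h3 h4
  · exact Nat.findGreatest_is_greatest h1 (by omega) ⟨hP.1.trans h1.le, h2, hs0.2.2.1, h4⟩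

section Counting

variable {n N : ℕ} {W : ℕ → Fin (n + 1)}

/-- The stretch from `x` to `s - 2` is `aba`-free and shares no letter with `[s, e)`, so its length
is at most twice the number of remaining letters. Position `s - 1` is left out because it is
adjacent to `s` and may carry the same letter. -/
theorem IsNext.le_add {x s e : ℕ} (h : IsNext W N x s e) :
    s + 2 * ((Finset.Ico s e).image W).card ≤ x + 1 + 2 * (n + 1) := by
  have h1 : s - 1 - x ≤ 2 * ((Finset.Ico x (x + (s - 1 - x))).image W).card :=
    length_le_of_spread fun a b ha hab hb => h.free_left a b ha hab (by have := h.add_two_le; omega)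
  have h2 : Disjoint ((Finset.Ico x (x + (s - 1 - x))).image W) ((Finset.Ico s e).image W) := by
    rw [Finset.disjoint_left]
    intro z hz hz'
    simp only [Finset.mem_image, Finset.mem_Ico] at hz hz'
    obtain ⟨a, ha, rfl⟩ := hz
    obtain ⟨b, hb, hab⟩ := hz'
    exact h.free_left a b ha.1 (by omega) hb.2 hab.symm
  have h3 := Finset.card_le_univ (((Finset.Ico x (x + (s - 1 - x))).image W) ∪
    ((Finset.Ico s e).image W))
  rw [Finset.card_union_of_disjoint h2, Fintype.card_fin] at h3
  have := h.le
  omega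

theorem IsNext.ne_of_mem {x s e : ℕ} (h : IsNext W N x s e)
    (hc : ¬(e = s + 2 ∧ W (s + 1) = W s)) {j : ℕ} (hj : s < j) (hj' : j < e) : W j ≠ W s := by
  intro hW
  rcases (show s + 1 ≤ j from hj).eq_or_lt with rfl | hlt
  · by_cases he : e = s + 2
    · exact hc ⟨he, hW⟩
    · exact h.free_right (s + 1) e (by omega) (by have := h.add_two_le; omega) le_rfl
        (hW.trans h.eq)
  · exact h.free_left s j h.le hlt hj' hW.symm

theorem card_last_le {P : ℕ → Prop} [DecidablePred P]
    (h : ∀ x, P x → ¬∃ a b, x ≤ a ∧ a + 2 ≤ b ∧ b < N ∧ W a = W b) :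
    ((Finset.range N).filter P).card ≤ 2 * (n + 1) := by
  calc _ ≤ (Finset.Ico (N - 2 * (n + 1)) N).card := by
        refine Finset.card_le_card fun x hx => ?_
        simp only [Finset.mem_filter, Finset.mem_range, Finset.mem_Ico] at hx ⊢
        have h1 : N - x ≤ 2 * ((Finset.Ico x (x + (N - x))).image W).card :=
          length_le_of_spread fun a b ha hab hb hW => h x hx.2 ⟨a, b, ha, hab, by omega, hW⟩
        have h2 := Finset.card_le_univ ((Finset.Ico x (x + (N - x))).image W)
        rw [Fintype.card_fin] at h2
        omega
    _ ≤ _ := by simp; omega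

/-- Two cubes of the same letter starting at distance at least 4 give `Z_3`, so all starts lie
within 3 of the least one, `s0`. By `IsNext.le_add`, `x` is at most `2 * n + 1` before its cube. -/
theorem card_cube_le (hW : ¬∃ p p' d, 2 ≤ d ∧ p + d + 2 ≤ p' ∧ p' + d < N ∧ W p = W (p + d) ∧
    ∀ t ≤ d, W (p + t) = W (p' + t)) (a : Fin (n + 1)) {P : ℕ → Prop} [DecidablePred P]
    (h : ∀ x, P x → ∃ s, IsNext W N x s (s + 2) ∧ W (s + 1) = W s ∧ W s = a) :
    ((Finset.range N).filter P).card ≤ 2 * (n + 1) + 3 := by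
  classical
  by_cases hT : ∃ s x, P x ∧ IsNext W N x s (s + 2) ∧ W (s + 1) = W s ∧ W s = a
  swap
  · rw [Finset.filter_false_of_mem]
    · simp
    · intro x _ hx
      obtain ⟨s, hs⟩ := h x hx
      exact hT ⟨s, x, hx, hs⟩
  · set s0 := Nat.find hT with hs0
    obtain ⟨x0, -, hn0, h01, h02⟩ := Nat.find_spec hT
    rw [← hs0] at hn0 h01 h02
    calc _ ≤ (Finset.Icc (s0 - (2 * n + 1)) (s0 + 3)).card := by
          refine Finset.card_le_card fun x hx => ?_
          simp only [Finset.mem_filter, Finset.mem_range, Finset.mem_Icc] at hx ⊢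
          obtain ⟨s, hn, h1, h2⟩ := h x hx.2
          have hle : s0 ≤ s := Nat.find_min' hT ⟨x, hx.2, hn, h1, h2⟩
          have h4 := hn.le_add
          have h5 : 0 < ((Finset.Ico s (s + 2)).image W).card :=
            Finset.card_pos.2 ⟨W s, Finset.mem_image_of_mem _ (by simp)⟩
          have h3 : s ≤ s0 + 3 := by
            by_contra hlt
            have hb0 := hn0.eq
            have hb := hn.eq
            refine hW ⟨s0, s, 2, le_rfl, by omega, hn.lt, hn0.eq, fun t ht => ?_⟩
            interval_cases t
            · simp [h02, h2]
            · rw [h01, h1, h02, h2]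
            · rw [← hb, ← hb0, h02, h2]
          have := hn.le
          omega
      _ ≤ _ := by simp; omega

/-- As `a ∉ Y`, two copies of `aYa` share at most an end letter. The outer two of three copies are
thus far enough apart to give `Z_3`, which leaves at most two starts; each accounts for at most `2 *
(n - k)` values of `x` by `IsNext.le_add`. -/
theorem card_part_le (hW : ¬∃ p p' d, 2 ≤ d ∧ p + d + 2 ≤ p' ∧ p' + d < N ∧ W p = W (p + d) ∧
    ∀ t ≤ d, W (p + t) = W (p' + t)) (a : Fin (n + 1)) (Y : List (Fin (n + 1))) {k : ℕ}
    (hk : k < n) (hY : Y.toFinset.card = k + 1) {P : ℕ → Prop} [DecidablePred P]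
    (h : ∀ x, P x → ∃ s e, IsNext W N x s e ∧ a ∉ Y ∧ W s = a ∧
      (List.range' (s + 1) (e - s - 1)).map W = Y) :
    ((Finset.range N).filter P).card ≤ 4 * (n - k) := by
  classical
  let T : ℕ → Prop := fun s => ∃ x e, IsNext W N x s e ∧ a ∉ Y ∧ W s = a ∧
      (List.range' (s + 1) (e - s - 1)).map W = Y
  have hd : ∀ s, T s → s + (Y.length + 1) < N ∧ W (s + (Y.length + 1)) = a ∧ W s = a ∧
      2 ≤ Y.length + 1 ∧
      ∀ t < Y.length, W (s + 1 + t) ≠ a ∧ some (W (s + 1 + t)) = Y[t]? := by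
    rintro s ⟨x, e, hn, ha, hs, hY⟩
    have hl := congrArg List.length hY
    simp only [List.length_map, List.length_range'] at hl
    have h2 := hn.add_two_le
    have he : s + (Y.length + 1) = e := by omega
    rw [he]
    refine ⟨hn.lt, hn.eq ▸ hs, hs, by omega, fun t ht => ?_⟩
    have hYt : some (W (s + 1 + t)) = Y[t]? := by
      rw [← hY, List.getElem?_map, List.getElem?_range' (by omega)]
      simp
    refine ⟨fun h => ha ?_, hYt⟩
    rw [h] at hYt
    exact List.mem_of_getElem? hYt.symm
  have hsep : ∀ s s', T s → T s' → s < s' → s + (Y.length + 1) ≤ s' := by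
    intro s s' hs hs' hlt
    by_contra hcon
    have := ((hd s hs).2.2.2.2 (s' - s - 1) (by omega)).1
    rw [show s + 1 + (s' - s - 1) = s' by omega] at this
    exact this (hd s' hs').2.2.1
  have hthree : ∀ s s' s'', T s → T s' → T s'' → s < s' → s' < s'' → False := by
    intro s s' s'' hs hs' hs'' h1 h2
    have e1 := hsep s s' hs hs' h1
    have e2 := hsep s' s'' hs' hs'' h2
    have d1 := hd s hs
    have d2 := hd s'' hs''
    refine hW ⟨s, s'', Y.length + 1, d1.2.2.2.1, by omega, d2.1, d1.2.2.1.trans d1.2.1.symm, ?_⟩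
    intro t ht
    rcases t with _ | t
    · exact d1.2.2.1.trans d2.2.2.1.symm
    · rcases (show t ≤ Y.length by omega).lt_or_eq with ht | rfl
      · have f1 := (d1.2.2.2.2 t ht).2
        have f2 := (d2.2.2.2.2 t ht).2
        rw [← f2] at f1
        rw [show s + (t + 1) = s + 1 + t by omega, show s'' + (t + 1) = s'' + 1 + t by omega]
        exact Option.some.inj f1
      · exact d1.2.1.trans d2.2.1.symm
  obtain ⟨s₁, s₂, hs⟩ : ∃ s₁ s₂, ∀ s, T s → s = s₁ ∨ s = s₂ := by
    by_contra! hcon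
    obtain ⟨u, hu, -⟩ := hcon 0 0
    obtain ⟨v, hv, hvu, -⟩ := hcon u u
    obtain ⟨w, hw, hwu, hwv⟩ := hcon u v
    rcases lt_or_gt_of_ne hvu with h1 | h1 <;> rcases lt_or_gt_of_ne hwu with h2 | h2 <;>
      rcases lt_or_gt_of_ne hwv with h3 | h3
    · exact hthree w v u hw hv hu h3 h1
    · exact hthree v w u hv hw hu h3 h2
    · omega
    · exact hthree v u w hv hu hw h1 h2
    · exact hthree w u v hw hu hv h2 h1
    · omega
    · exact hthree u w v hu hw hv h2 h3
    · exact hthree u v w hu hv hw h1 h3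
  calc _ ≤ (Finset.Icc (s₁ - (2 * (n - k) - 1)) s₁ ∪
        Finset.Icc (s₂ - (2 * (n - k) - 1)) s₂).card := by
        refine Finset.card_le_card fun x hx => ?_
        simp only [Finset.mem_filter, Finset.mem_range, Finset.mem_union, Finset.mem_Icc] at hx ⊢
        obtain ⟨s, e, hn, ha, hsa, hYe⟩ := h x hx.2
        have hcard : ((Finset.Ico s e).image W).card = k + 2 := by
          have h2 := hn.add_two_le
          have hY' := hY
          rw [← hYe] at hY'
          rw [← Finset.insert_Ico_add_one_left_eq_Ico (by omega : s < e), Finset.image_insert,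
            Finset.card_insert_of_notMem]
          · rw [toFinset_map_range', show s + 1 + (e - s - 1) = e by omega] at hY'
            omega
          · intro hm
            apply ha
            rw [← hYe, ← List.mem_toFinset, toFinset_map_range',
              show s + 1 + (e - s - 1) = e by omega, ← hsa]
            exact hm
        have h4 := hn.le_add
        rw [hcard] at h4
        have := hn.le
        rcases hs s ⟨x, e, hn, ha, hsa, hYe⟩ with rfl | rfl
        · left; omega
        · right; omega
    _ ≤ _ := by
        refine (Finset.card_union_le _ _).trans ?_
        simp only [Nat.card_Icc]
        omega

theorem length_le_of_not_repeat (hW : ¬∃ p p' d, 2 ≤ d ∧ p + d + 2 ≤ p' ∧ p' + d < N ∧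
    W p = W (p + d) ∧ ∀ t ≤ d, W (p + t) = W (p' + t)) :
    N ≤ 2 * (n + 1) + (n + 1) * (2 * (n + 1) + 3) + (n + 1) * ∑ k ∈ Finset.range n,
      2 ^ (k + 1) * n.descFactorial (k + 1) * (4 * (n - k)) := by
  classical
  let P₀ : ℕ → Prop := fun x => ¬∃ a b, x ≤ a ∧ a + 2 ≤ b ∧ b < N ∧ W a = W b
  let P₁ : Fin (n + 1) → ℕ → Prop := fun a x =>
    ∃ s, IsNext W N x s (s + 2) ∧ W (s + 1) = W s ∧ W s = a
  let P₂ : Fin (n + 1) → List (Fin (n + 1)) → ℕ → ℕ → Prop := fun a Y k x =>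
    Y.toFinset.card = k + 1 ∧ ∃ s e, IsNext W N x s e ∧ a ∉ Y ∧ W s = a ∧
      (List.range' (s + 1) (e - s - 1)).map W = Y
  have hcover : Finset.range N ⊆ ((Finset.range N).filter P₀ ∪
      Finset.univ.biUnion fun a => (Finset.range N).filter (P₁ a)) ∪
      Finset.univ.biUnion fun a => (Finset.range n).biUnion fun k =>
        (runWords (k + 1) (Finset.univ.erase a)).biUnion fun Y =>
          (Finset.range N).filter (P₂ a Y k) := by
    intro x hx
    simp only [Finset.mem_union, Finset.mem_biUnion, Finset.mem_filter, Finset.mem_univ, true_and,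
      hx]
    by_cases h0 : P₀ x
    · exact Or.inl (Or.inl h0)
    obtain ⟨s, e, hn⟩ := exists_isNext (not_not.1 h0)
    by_cases hc : e = s + 2 ∧ W (s + 1) = W s
    · obtain ⟨rfl, hc⟩ := hc
      exact Or.inl (Or.inr ⟨W s, s, hn, hc, rfl⟩)
    right
    set Y := (List.range' (s + 1) (e - s - 1)).map W with hY
    have h2 := hn.add_two_le
    have haY : W s ∉ Y := by
      intro hm
      rw [hY, List.mem_map] at hm
      obtain ⟨j, hj, hj'⟩ := hm
      rw [List.mem_range'_1] at hj
      exact hn.ne_of_mem hc (by omega) (by omega) hj'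
    have hfree : SpreadFree Y := spreadFree_map_range' W _ _ fun a b h1 h2 h3 =>
      hn.free_left a b (by have := hn.le; omega) h2 (by omega)
    have hsub : Y.toFinset ⊆ Finset.univ.erase (W s) := fun z hz =>
      Finset.mem_erase.2 ⟨fun h => haY (by rw [← h]; simpa using hz), Finset.mem_univ _⟩
    have hpos : 0 < Y.toFinset.card := by
      rw [Finset.card_pos, List.toFinset_nonempty_iff]
      intro h
      have := congrArg List.length h
      simp [hY] at this
      omega
    have hle : Y.toFinset.card ≤ n := by
      simpa using Finset.card_le_card hsub
    have hk : Y.toFinset.card - 1 + 1 = Y.toFinset.card := by omega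
    refine ⟨W s, Y.toFinset.card - 1, ?_, Y, ?_, hk.symm, s, e, hn, haY, rfl, rfl⟩
    · simp; omega
    · rw [hk]
      exact hfree.mem_runWords _ _ hsub
  have hcard := Finset.card_le_card hcover
  rw [Finset.card_range] at hcard
  refine hcard.trans ((Finset.card_union_le _ _).trans
    (add_le_add ((Finset.card_union_le _ _).trans (add_le_add ?_ ?_)) ?_))
  · exact card_last_le fun x hx => hx
  · refine Finset.card_biUnion_le.trans ((Finset.sum_le_sum fun a _ =>
      card_cube_le hW a fun x hx => hx).trans ?_)
    simp
  · refine Finset.card_biUnion_le.trans ((Finset.sum_le_sum (g := fun _ => ∑ k ∈ Finset.range n,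
      2 ^ (k + 1) * n.descFactorial (k + 1) * (4 * (n - k))) fun a _ => ?_).trans ?_)
    · refine Finset.card_biUnion_le.trans (Finset.sum_le_sum fun k hk => ?_)
      refine Finset.card_biUnion_le.trans ((Finset.sum_le_sum (g := fun _ => 4 * (n - k))
        fun Y _ => ?_).trans ?_)
      · by_cases hY : Y.toFinset.card = k + 1
        · exact card_part_le hW a Y (Finset.mem_range.1 hk) hY fun x hx => hx.2
        · rw [Finset.filter_false_of_mem]
          · simp
          · exact fun x _ hx => hY hx.1
      · rw [Finset.sum_const, smul_eq_mul]
        refine Nat.mul_le_mul_right _ ?_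
        simpa using card_runWords_le (k + 1) (Finset.univ.erase a)
    · simp

end Counting

/-! ### Upper bound: evaluating the sum -/

/-- The full series is `(1 + t) e^t` at `t = 1/2`, since `∑ m t^m / m! = t e^t`. -/
theorem exp_sum_bound (M : ℕ) :
    ∑ m ∈ Finset.range (M + 1), ((m : ℝ) + 1) * ((1 / 2) ^ m / m.factorial) ≤
      3 / 2 * Real.exp (1 / 2) := by
  have h1 := Real.sum_le_exp_of_nonneg (x := 1 / 2) (by norm_num) (M + 1)
  have h2 := Real.sum_le_exp_of_nonneg (x := 1 / 2) (by norm_num) M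
  have h3 : ∑ m ∈ Finset.range (M + 1), (m : ℝ) * ((1 / 2) ^ m / m.factorial) =
      1 / 2 * ∑ m ∈ Finset.range M, ((1 / 2 : ℝ) ^ m / m.factorial) := by
    rw [Finset.sum_range_succ', Finset.mul_sum]
    simp only [Nat.cast_zero, zero_mul, add_zero]
    refine Finset.sum_congr rfl fun m _ => ?_
    rw [Nat.factorial_succ]
    have : (m.factorial : ℝ) ≠ 0 := by positivity
    have : (m : ℝ) + 1 ≠ 0 := by positivity
    push_cast
    field_simp
    ring
  simp only [add_mul, one_mul, Finset.sum_add_distrib]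
  rw [h3]
  linarith

/-- The substitution is `m = n - 1 - k`, the number of letters in neither `a` nor `Y`. -/
theorem count_eq (n : ℕ) :
    (((n + 1) * ∑ k ∈ Finset.range n,
      2 ^ (k + 1) * n.descFactorial (k + 1) * (4 * (n - k)) : ℕ) : ℝ) =
    2 * 2 ^ (n + 1) * (n + 1).factorial *
      ∑ m ∈ Finset.range n, ((m : ℝ) + 1) * ((1 / 2) ^ m / m.factorial) := by
  rw [← Finset.sum_range_reflect]
  push_cast
  rw [Finset.mul_sum, Finset.mul_sum]
  refine Finset.sum_congr rfl fun m hm => ?_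
  rw [Finset.mem_range] at hm
  obtain ⟨r, rfl⟩ : ∃ r, n = m + r + 1 := ⟨n - m - 1, by omega⟩
  have e1 : m + r + 1 - 1 - m = r := by omega
  have e2 : m + r + 1 - r = m + 1 := by omega
  have hd := Nat.factorial_mul_descFactorial (n := m + r + 1) (k := r + 1) (by omega)
  rw [show m + r + 1 - (r + 1) = m by omega] at hd
  rw [e1, e2, Nat.factorial_succ, ← hd]
  have : (m.factorial : ℝ) ≠ 0 := by positivity
  push_cast
  rw [one_div, inv_pow]
  field_simp
  ring

/-- The terms `m = n` and `m = n + 1` of the series are not used by the main sum. Scaled, they equal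
`4(n+1)^2` and `2(n+2)`, which together exceed the quadratic remainder. -/
theorem count_lt {n : ℕ} (hn : 1 ≤ n) :
    ((2 * (n + 1) + (n + 1) * (2 * (n + 1) + 3) + (n + 1) * ∑ k ∈ Finset.range n,
      2 ^ (k + 1) * n.descFactorial (k + 1) * (4 * (n - k)) + 1 : ℕ) : ℝ) <
      3 * Real.exp (1 / 2) * 2 ^ (n + 1) * (n + 1).factorial := by
  have h := exp_sum_bound (n + 1)
  rw [Finset.sum_range_succ, Finset.sum_range_succ] at h
  have hQ : (0 : ℝ) < 2 * 2 ^ (n + 1) * (n + 1).factorial := by positivity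
  have h2 := mul_le_mul_of_nonneg_left h hQ.le
  have e1 : 2 * 2 ^ (n + 1) * ((n + 1).factorial : ℝ) * (((n : ℝ) + 1) *
      ((1 / 2) ^ n / n.factorial)) = 4 * ((n : ℝ) + 1) ^ 2 := by
    have : (n.factorial : ℝ) ≠ 0 := by positivity
    rw [Nat.factorial_succ, one_div, inv_pow]
    push_cast
    field_simp
    ring
  have e2 : 2 * 2 ^ (n + 1) * ((n + 1).factorial : ℝ) * ((((n + 1 : ℕ) : ℝ) + 1) *
      ((1 / 2) ^ (n + 1) / (n + 1).factorial)) = 2 * ((n : ℝ) + 2) := by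
    have : ((n + 1).factorial : ℝ) ≠ 0 := by positivity
    rw [one_div, inv_pow]
    push_cast
    field_simp
    ring
  rw [mul_add, mul_add, e1, e2, ← count_eq] at h2
  have hn' : (1 : ℝ) ≤ n := by exact_mod_cast hn
  push_cast at h2 ⊢
  nlinarith

theorem exists_eq_map_range {q N : ℕ} (w : List (Fin (q + 1))) (hw : w.length = N) :
    ∃ W : ℕ → Fin (q + 1), w = (List.range N).map W := by
  refine ⟨fun i => w.getD i 0, List.ext_getElem (by simp [hw]) fun i h1 h2 => ?_⟩
  simp [h1]

theorem count_mem_forcingLengths (n : ℕ) :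
    2 * (n + 1) + (n + 1) * (2 * (n + 1) + 3) + (n + 1) * ∑ k ∈ Finset.range n,
      2 ^ (k + 1) * n.descFactorial (k + 1) * (4 * (n - k)) + 1 ∈ forcingLengths 3 (n + 1) := by
  intro w hw
  obtain ⟨W, rfl⟩ := exists_eq_map_range w hw
  rw [contains_zimin_three_iff]
  by_contra h
  have := length_le_of_not_repeat h
  omega

theorem f_three_lt {q : ℕ} (hq : 2 ≤ q) :
    (f 3 q : ℝ) < 3 * Real.exp (1 / 2) * 2 ^ q * (q.factorial : ℝ) := by
  obtain ⟨n, rfl⟩ : ∃ n, q = n + 1 := ⟨q - 1, by omega⟩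
  refine lt_of_le_of_lt ?_ (count_lt (n := n) (by omega))
  exact_mod_cast Nat.sInf_le (count_mem_forcingLengths n)

theorem isLeast_f_three {q : ℕ} (hq : 1 ≤ q) : IsLeast (forcingLengths 3 q) (f 3 q) := by
  obtain ⟨n, rfl⟩ : ∃ n, q = n + 1 := ⟨q - 1, by omega⟩
  exact ⟨Nat.sInf_mem ⟨_, count_mem_forcingLengths n⟩, fun _ h => Nat.sInf_le h⟩

/-! ### Eulerian circuits with restricted transitions -/

open Equiv

/-- Exchanging the images of two points of different cycles merges the two cycles. -/
theorem sameCycle_mul_swap {E : Type*} [Finite E] [DecidableEq E] {σ : Perm E} {x y : E}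
    (h : ¬σ.SameCycle x y) :
    (σ * swap x y).SameCycle x y ∧ ∀ z, σ.SameCycle x z → (σ * swap x y).SameCycle x z := by
  set τ := σ * swap x y with hτ
  have hy : τ y = σ x := by simp [hτ]
  have hother : ∀ z, z ≠ x → z ≠ y → τ z = σ z := fun z h1 h2 => by
    simp [hτ, swap_apply_of_ne_of_ne h1 h2]
  have key : ∀ k : ℕ, τ.SameCycle y ((σ ^ (k + 1)) x) := by
    intro k
    induction k with
    | zero =>
      rw [zero_add, pow_one, ← hy]
      exact Perm.sameCycle_apply_right.2 (Perm.SameCycle.refl _ _)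
    | succ k ih =>
      rw [pow_succ', Perm.mul_apply]
      by_cases hx : (σ ^ (k + 1)) x = x
      · rw [hx, ← hy]
        exact Perm.sameCycle_apply_right.2 (Perm.SameCycle.refl _ _)
      · rw [← hother _ hx fun hy' => h ⟨(k + 1 : ℕ), by rwa [zpow_natCast]⟩]
        exact Perm.sameCycle_apply_right.2 ih
  have hz : ∀ z, σ.SameCycle x z → τ.SameCycle y z := by
    intro z hz
    obtain ⟨i, hi, -, rfl⟩ := hz.exists_pow_eq''
    obtain ⟨k, rfl⟩ : ∃ k, i = k + 1 := ⟨i - 1, by omega⟩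
    exact key k
  have hx := hz x (Perm.SameCycle.refl _ _)
  exact ⟨hx.symm, fun z h => hx.symm.trans (hz z h)⟩

/-- Edges `e` with end vertex `tail e` and colour `c e`, two edges `e`, `α e` of each colour at
each vertex, and a bijection `σ₀` from the edges to the edges such that `σ₀ e` leaves `tail e`.
If this digraph is connected, it has an Eulerian circuit which changes the colour
after at most one of `e`, `α e`. -/
theorem exists_transitive_transition {E V κ : Type*} [Finite E] [Nonempty E] (tail : E → V)
    (c : E → κ) (α : E → E) (hα : ∀ e, α (α e) = e) (hα' : ∀ e, α e ≠ e)
    (htα : ∀ e, tail (α e) = tail e) (hcα : ∀ e, c (α e) = c e)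
    (hclass : ∀ x y, tail x = tail y → c x = c y → y = x ∨ y = α x) (σ₀ : Perm E)
    (hconn : ∀ C : Set E, C.Nonempty → (∀ x y, tail x = tail y → x ∈ C → y ∈ C) →
      (∀ x, x ∈ C ↔ σ₀ x ∈ C) → ∀ x, x ∈ C) :
    ∃ τ : Perm E, (∀ e, tail (τ e) = tail e) ∧
      (∀ e, ¬(c (τ e) ≠ c e ∧ c (τ (α e)) ≠ c e)) ∧ ∀ x y, (σ₀ * τ).SameCycle x y := by
  classical
  have := Fintype.ofFinite E
  obtain ⟨e₀⟩ := ‹Nonempty E›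
  let Ok : Perm E → Prop := fun τ => (∀ e, tail (τ e) = tail e) ∧
      ∀ e, ¬(c (τ e) ≠ c e ∧ c (τ (α e)) ≠ c e)
  have h1 : Ok 1 := ⟨fun e => rfl, fun e h => h.1 rfl⟩
  -- Among admissible `τ`, one whose cycle through `e₀` is largest: no swap that merges this cycle
  -- with another can then be admissible.
  obtain ⟨τ, hτ, hmax⟩ := Finset.exists_max_image (Finset.univ.filter Ok)
    (fun τ => (Finset.univ.filter fun x => (σ₀ * τ).SameCycle e₀ x).card) ⟨1, by simpa using h1⟩
  simp only [Finset.mem_filter, Finset.mem_univ, true_and] at hτ hmax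
  obtain ⟨ht, hret⟩ := hτ
  have hmerge : ∀ x y, tail x = tail y → (σ₀ * τ).SameCycle e₀ x → ¬(σ₀ * τ).SameCycle e₀ y →
      ¬Ok (τ * swap x y) := by
    intro x y hxy hx hy hok
    have hle := hmax _ hok
    rw [← mul_assoc] at hle
    obtain ⟨m1, m2⟩ := sameCycle_mul_swap (σ := σ₀ * τ) (x := x) (y := y)
      fun h => hy (hx.trans h)
    have mx := m2 e₀ hx.symm
    refine absurd hle (not_le.2 (Finset.card_lt_card ⟨fun z hz => ?_, fun hsub => hy ?_⟩))
    · simp only [Finset.mem_filter, Finset.mem_univ, true_and] at hz ⊢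
      exact mx.symm.trans (m2 z (hx.symm.trans hz))
    · have : y ∈ Finset.univ.filter fun x => (σ₀ * τ).SameCycle e₀ x := hsub (by
        simp only [Finset.mem_filter, Finset.mem_univ, true_and]
        exact mx.symm.trans m1)
      simpa using this
  have htail : ∀ x y, tail x = tail y → ∀ e, tail ((τ * swap x y) e) = tail e := by
    intro x y hxy e
    rw [Perm.mul_apply, ht]
    by_cases hx : e = x
    · subst hx; simp [hxy]
    · by_cases hy : e = y
      · subst hy; simp [hxy]
      · rw [swap_apply_of_ne_of_ne hx hy]
  have hsame : ∀ x, (σ₀ * τ).SameCycle e₀ x → (σ₀ * τ).SameCycle e₀ (α x) := by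
    intro x hx
    by_contra hy
    -- Swapping the images of `x` and `α x`, which have the same colour, only exchanges their roles
    -- in the colour condition.
    refine hmerge x (α x) (htα x).symm hx hy ⟨htail _ _ (htα x).symm, fun e he => ?_⟩
    have hr := hret x
    simp only [Perm.mul_apply] at he
    by_cases h1 : e = x
    · subst h1
      rw [swap_apply_left, swap_apply_right] at he
      exact hr he.symm
    · by_cases h2 : e = α x
      · subst h2
        rw [hα, swap_apply_left, swap_apply_right, hcα] at he
        exact hr he
      · rw [swap_apply_of_ne_of_ne h1 h2, swap_apply_of_ne_of_ne
          (fun h => h2 (by rw [← h, hα])) (fun h => h1 (by rw [← hα e, h, hα]))] at he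
        exact hret e he
  have hsib : ∀ x y, tail x = tail y → (σ₀ * τ).SameCycle e₀ x → (σ₀ * τ).SameCycle e₀ y := by
    intro x y hxy hx
    by_contra hy
    have hc : c x ≠ c y := fun hc => by
      rcases hclass x y hxy hc with rfl | rfl
      · exact hy hx
      · exact hy (hsame x hx)
    -- From each pair, the edge chosen is one whose partner keeps its colour. Swapping the images of
    -- two chosen edges is then harmless, whatever colours result.
    have pick : ∀ z, ∃ z', (z' = z ∨ z' = α z) ∧ c (τ (α z')) = c z' := by
      intro z
      by_cases hz : c (τ (α z)) = c z
      · exact ⟨z, Or.inl rfl, hz⟩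
      · refine ⟨α z, Or.inr rfl, ?_⟩
        by_contra h
        rw [hα, hcα] at h
        exact hret z ⟨h, hz⟩
    obtain ⟨x', hx', rx⟩ := pick x
    obtain ⟨y', hy', ry⟩ := pick y
    have hxC : (σ₀ * τ).SameCycle e₀ x' := by
      rcases hx' with rfl | rfl
      exacts [hx, hsame x hx]
    have hyC : ¬(σ₀ * τ).SameCycle e₀ y' := by
      rcases hy' with rfl | rfl
      · exact hy
      · exact fun h => hy (by simpa [hα] using hsame _ h)
    have htx : tail x' = tail x := by rcases hx' with rfl | rfl <;> simp [htα]
    have hty : tail y' = tail y := by rcases hy' with rfl | rfl <;> simp [htα]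
    have hcx : c x' = c x := by rcases hx' with rfl | rfl <;> simp [hcα]
    have hcy : c y' = c y := by rcases hy' with rfl | rfl <;> simp [hcα]
    have hc' : c x' ≠ c y' := by rwa [hcx, hcy]
    have ht' : tail x' = tail y' := by rw [htx, hty, hxy]
    refine hmerge x' y' ht' hxC hyC ⟨htail _ _ ht', fun e he => ?_⟩
    simp only [Perm.mul_apply] at he
    have fixx : swap x' y' (α x') = α x' :=
      swap_apply_of_ne_of_ne (hα' _) fun h => hc' (by rw [← h, hcα])
    have fixy : swap x' y' (α y') = α y' :=
      swap_apply_of_ne_of_ne (fun h => hc' (by rw [← h, hcα])) (hα' _)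
    by_cases h1 : e = x'
    · subst h1
      rw [fixx] at he
      exact he.2 rx
    by_cases h2 : e = y'
    · subst h2
      rw [fixy] at he
      exact he.2 ry
    by_cases h3 : e = α x'
    · subst h3
      rw [fixx, hcα] at he
      exact he.1 rx
    by_cases h4 : e = α y'
    · subst h4
      rw [fixy, hcα] at he
      exact he.1 ry
    rw [swap_apply_of_ne_of_ne h1 h2, swap_apply_of_ne_of_ne
      (fun h => h3 (by rw [← h, hα])) (fun h => h4 (by rw [← h, hα]))] at he
    exact hret e he
  have hall := hconn {x | (σ₀ * τ).SameCycle e₀ x} ⟨e₀, Perm.SameCycle.refl _ _⟩ hsib fun x => by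
    have h2 : (σ₀ * τ).SameCycle e₀ (σ₀ x) ↔ (σ₀ * τ).SameCycle e₀ (τ⁻¹ x) := by
      rw [← Perm.sameCycle_apply_right (x := e₀) (y := τ⁻¹ x)]
      simp
    have h3 : tail (τ⁻¹ x) = tail x := by
      rw [← ht (τ⁻¹ x)]; simp
    exact (Iff.intro (hsib _ _ h3.symm) (hsib _ _ h3)).trans h2.symm
  exact ⟨τ, ht, hret, fun x y => (hall x).symm.trans (hall y)⟩

/-! ### The digraph of windows -/

/-- Windows of `k + 1` runs with distinct letters out of `k + 2`: run `i` has the letter `e.1 i`,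
and is double if `e.2 i`. The missing letter is `e.1 (Fin.last _)`. -/
abbrev Window (k : ℕ) : Type := Perm (Fin (k + 2)) × (Fin (k + 1) → Bool)

namespace Window

variable {k : ℕ}

/-- The runs of a window, all but the first. -/
def tail (e : Window k) : (Fin k → Fin (k + 2)) × (Fin k → Bool) :=
  (fun i => e.1 i.succ.castSucc, fun i => e.2 i.succ)

/-- Changes the multiplicity of the first run. -/
def flip (e : Window k) : Window k := (e.1, Function.update e.2 0 (!e.2 0))

/-- Drops the first run, and appends a run with the missing letter. -/
def rotate (k : ℕ) : Perm (Window k) :=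
  (Equiv.mulRight (finRotate (k + 2))).prodCongr ((finRotate (k + 1)).symm.arrowCongr (Equiv.refl _))

theorem rotate_fst (e : Window k) (i : Fin (k + 2)) : (rotate k e).1 i = e.1 (i + 1) := by
  simp [rotate]

theorem rotate_snd (e : Window k) (i : Fin (k + 1)) : (rotate k e).2 i = e.2 (i + 1) := by
  simp [rotate]

theorem flip_flip (e : Window k) : flip (flip e) = e := by
  simp [flip]

theorem flip_ne (e : Window k) : flip e ≠ e := by
  intro h
  have := congrFun (congrArg Prod.snd h) 0
  simp [flip] at this

theorem tail_flip (e : Window k) : tail (flip e) = tail e := by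
  simp [flip, tail]

theorem eq_or_eq_flip {x y : Window k} (h : tail x = tail y) (h0 : x.1 0 = y.1 0) :
    y = x ∨ y = flip x := by
  obtain ⟨π, m⟩ := x
  obtain ⟨π', m'⟩ := y
  simp only [tail, Prod.mk.injEq, funext_iff] at h h0
  have hπ : ∀ i : Fin (k + 1), π i.castSucc = π' i.castSucc := by
    intro i
    refine Fin.cases ?_ (fun i => h.1 i) i
    simpa using h0
  have hπ' : π = π' := by
    ext i
    congr 1
    refine Fin.lastCases ?_ hπ i
    obtain ⟨j, hj⟩ := π'.surjective (π (Fin.last _))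
    rw [← hj]
    congr 1
    by_contra hne
    obtain ⟨j, rfl⟩ := Fin.exists_castSucc_eq.2 hne
    rw [← hπ] at hj
    exact (Fin.castSucc_lt_last j).ne (π.injective hj)
  subst hπ'
  have hm : ∀ b, m' 0 = b → m' = Function.update m 0 b := by
    rintro b rfl
    ext i
    refine Fin.cases ?_ (fun i => ?_) i
    · simp
    · simp [h.2 i]
  rcases Bool.eq_or_eq_not (m' 0) (m 0) with h1 | h1
  · left; rw [hm _ h1, Function.update_eq_self]
  · right; simp only [flip, hm _ h1]

/-- Siblings allow changing the multiplicity of the first run and exchanging its letter with the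
missing one; rotation carries the former to every run. On letters, rotation is a full cycle and the
exchange an adjacent transposition, and these generate the symmetric group. -/
theorem connected (C : Set (Window k)) (hne : C.Nonempty)
    (hsib : ∀ x y, tail x = tail y → x ∈ C → y ∈ C) (hrot : ∀ x, x ∈ C ↔ rotate k x ∈ C) :
    ∀ x, x ∈ C := by
  have hupd : ∀ (i : Fin (k + 1)) π m b, (π, m) ∈ C → (π, Function.update m i b) ∈ C := by
    intro i
    induction i using Fin.induction with
    | zero =>
      intro π m b h
      refine hsib _ _ ?_ h
      simp [tail]
    | succ i ih =>
      intro π m b h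
      rw [hrot] at h ⊢
      have h' := ih _ _ b h
      convert h' using 1
      refine Prod.ext rfl (funext fun j => ?_)
      rw [rotate_snd]
      simp only [Function.update_apply, ← Fin.coeSucc_eq_succ, add_left_inj]
      split_ifs
      · rfl
      · exact (rotate_snd (π, m) j).symm
  have hbits : ∀ π m m', (π, m) ∈ C → (π, m') ∈ C := by
    intro π m m' h
    have : ∀ s : Finset (Fin (k + 1)), (π, fun i => if i ∈ s then m' i else m i) ∈ C := by
      intro s
      induction s using Finset.induction_on with
      | empty => simpa using h
      | insert a s ha ih =>
        convert hupd a _ _ (m' a) ih using 2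
        funext i
        rw [Function.update_apply]
        by_cases hi : i = a
        · simp [hi]
        · simp [hi]
    simpa using this Finset.univ
  have hgrp : ∀ g : Perm (Fin (k + 2)), ∀ π m, (π, m) ∈ C ↔ (π * g, m) ∈ C := by
    intro g
    have hg : g ∈ Subgroup.closure ({finRotate (k + 2), swap (Fin.last (k + 1))
        (finRotate (k + 2) (Fin.last (k + 1)))} : Set (Perm (Fin (k + 2)))) := by
      rw [Perm.closure_cycle_adjacent_swap isCycle_finRotate support_finRotate]
      trivial
    induction hg using Subgroup.closure_induction with
    | mem g hg =>
      intro π m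
      rcases hg with rfl | rfl
      · rw [hrot]
        exact ⟨hbits _ _ _, hbits _ _ _⟩
      · rw [finRotate_last]
        have ht : tail (π, m) = tail (π * swap (Fin.last (k + 1)) 0, m) := by
          simp only [tail, Prod.mk.injEq, and_true]
          funext i
          rw [Perm.mul_apply, swap_apply_of_ne_of_ne (Fin.castSucc_lt_last _).ne]
          simp [Fin.ext_iff]
        exact ⟨hsib _ _ ht, hsib _ _ ht.symm⟩
    | one => simp
    | mul g h _ _ ihg ihh =>
      intro π m
      rw [ihg π m, ihh (π * g) m, mul_assoc]
    | inv g _ ih =>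
      intro π m
      rw [ih (π * g⁻¹) m]
      simp
  rintro ⟨π, m⟩
  obtain ⟨⟨π', m'⟩, h⟩ := hne
  have := (hgrp (π'⁻¹ * π) π' m').1 h
  rw [mul_inv_cancel_left] at this
  exact hbits _ _ _ this

end Window

/-! ### Words given by their runs -/

section Runs

variable {α : Type*} {a : ℕ → α} {l : ℕ → ℕ}

/-- The position at which run `j` starts, if run `i` has length `l i`. -/
def runStart (l : ℕ → ℕ) (j : ℕ) : ℕ := ∑ i ∈ Finset.range j, l i

/-- The infinite word whose run `i` consists of `l i` letters `a i`. -/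
def runWord (a : ℕ → α) (l : ℕ → ℕ) (p : ℕ) : α :=
  a (Nat.findGreatest (fun j => runStart l j ≤ p) p)

theorem runStart_succ (l : ℕ → ℕ) (j : ℕ) : runStart l (j + 1) = runStart l j + l j :=
  Finset.sum_range_succ _ _

theorem runStart_strictMono (hl : ∀ j, 1 ≤ l j) : StrictMono (runStart l) :=
  strictMono_nat_of_lt_succ fun j => by
    rw [runStart_succ]
    have := hl j
    omega

theorem runWord_eq (hl : ∀ j, 1 ≤ l j) {j x : ℕ} (h1 : runStart l j ≤ x)
    (h2 : x < runStart l (j + 1)) : runWord a l x = a j := by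
  have hm := runStart_strictMono hl
  rw [runWord]
  congr 1
  rw [Nat.findGreatest_eq_iff]
  refine ⟨(hm.le_apply).trans h1, fun _ => h1, fun i hi _ h => ?_⟩
  exact absurd (hm.monotone (show j + 1 ≤ i from hi)) (by omega)

theorem exists_run (hl : ∀ j, 1 ≤ l j) (x : ℕ) :
    ∃ j, runStart l j ≤ x ∧ x < runStart l (j + 1) := by
  have hm := runStart_strictMono hl
  refine ⟨Nat.findGreatest (fun j => runStart l j ≤ x) x, ?_, ?_⟩
  · exact Nat.findGreatest_spec (P := fun j => runStart l j ≤ x) (Nat.zero_le x)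
      (by simp [runStart])
  · by_contra h
    rw [not_lt] at h
    exact Nat.findGreatest_is_greatest (P := fun j => runStart l j ≤ x) (Nat.lt_succ_self _)
      ((hm.le_apply).trans h) h

theorem runStart_le_of_ne (hl : ∀ j, 1 ≤ l j) {j x y : ℕ} (h1 : runStart l j ≤ x) (hxy : x ≤ y)
    (h : runWord a l y ≠ a j) : runStart l (j + 1) ≤ y := by
  by_contra hlt
  exact h (runWord_eq hl (h1.trans hxy) (by omega))

theorem runWord_runStart (hl : ∀ j, 1 ≤ l j) (j : ℕ) : runWord a l (runStart l j) = a j :=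
  runWord_eq hl le_rfl (runStart_strictMono hl (Nat.lt_succ_self j))

/-- Adjacent runs have different letters, so equal factors change letter at the same offset, even if
they start inside runs. -/
theorem runStart_sub_eq (hl : ∀ j, 1 ≤ l j) (ha : ∀ j, a (j + 1) ≠ a j) {i i' p p' d : ℕ}
    (h1 : runStart l i ≤ p) (h2 : p < runStart l (i + 1)) (h1' : runStart l i' ≤ p')
    (h2' : p' < runStart l (i' + 1)) (h : ∀ t ≤ d, runWord a l (p + t) = runWord a l (p' + t))
    (hd : runStart l (i + 1) ≤ p + d) :
    runStart l (i' + 1) + p = runStart l (i + 1) + p' := by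
  have hii : a i = a i' := by
    have := h 0 (by omega)
    simpa [runWord_eq hl h1 h2, runWord_eq hl h1' h2'] using this
  apply le_antisymm
  · have := h (runStart l (i + 1) - p) (by omega)
    rw [show p + (runStart l (i + 1) - p) = runStart l (i + 1) by omega,
      runWord_runStart hl] at this
    have := runStart_le_of_ne (y := p' + (runStart l (i + 1) - p)) hl h1' (by omega)
      (by rw [← this, ← hii]; exact ha i)
    omega
  · by_contra hlt
    have := h (runStart l (i' + 1) - p') (by omega)
    rw [show p' + (runStart l (i' + 1) - p') = runStart l (i' + 1) by omega,
      runWord_runStart hl] at this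
    have := runStart_le_of_ne (y := p + (runStart l (i' + 1) - p')) hl h1 (by omega)
      (by rw [this, hii]; exact ha i')
    omega

theorem runStart_add_eq (hl : ∀ j, 1 ≤ l j) (ha : ∀ j, a (j + 1) ≠ a j) {i i' p p' d : ℕ}
    (h1 : runStart l i ≤ p) (h2 : p < runStart l (i + 1)) (h1' : runStart l i' ≤ p')
    (h2' : p' < runStart l (i' + 1)) (h : ∀ t ≤ d, runWord a l (p + t) = runWord a l (p' + t))
    (t : ℕ) (hd : runStart l (i + t + 1) ≤ p + d) :
    runStart l (i' + t + 1) + p = runStart l (i + t + 1) + p' := by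
  have hm := runStart_strictMono hl
  induction t with
  | zero => exact runStart_sub_eq hl ha h1 h2 h1' h2' h hd
  | succ t ih =>
    rw [← add_assoc i, ← add_assoc i'] at *
    have hlt := hm (Nat.lt_succ_self (i + t + 1))
    have hlt' := hm (Nat.lt_succ_self (i' + t + 1))
    rw [Nat.succ_eq_add_one] at hlt hlt'
    have ih' := ih (by omega)
    have hp : p ≤ runStart l (i + t + 1) := h2.le.trans (hm.monotone (by omega))
    have := runStart_sub_eq (d := p + d - runStart l (i + t + 1)) hl ha le_rfl hlt le_rfl hlt'
      (fun s hs => by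
        have := h (runStart l (i + t + 1) - p + s) (by omega)
        rwa [show p + (runStart l (i + t + 1) - p + s) = runStart l (i + t + 1) + s by omega,
          show p' + (runStart l (i + t + 1) - p + s) = runStart l (i' + t + 1) + s by omega]
            at this) (by omega)
    omega

/-- If any `k + 1` consecutive runs have distinct letters, and among the first `n` runs, a run `j`
is determined by the `k + 1` runs from `j` on, and also by their letters and the
lengths of all but the first if run `j + k + 1` has the same letter as run `j`, then the
prefix made of the first `n + k` runs avoids `Z_3`. -/
theorem runWord_not_repeat {k n : ℕ} (hk : 1 ≤ k) (hl : ∀ j, 1 ≤ l j) (hl2 : ∀ j, l j ≤ 2)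
    (hdist : ∀ j i, 1 ≤ i → i ≤ k → a (j + i) ≠ a j)
    (hret : ∀ j j', j < n → j' < n → (∀ i ≤ k, a (j + i) = a (j' + i)) →
      (∀ i, 1 ≤ i → i ≤ k → l (j + i) = l (j' + i)) → a (j + k + 1) = a j →
      a (j' + k + 1) = a j' → j = j')
    (huniq : ∀ j j', j < n → j' < n → (∀ i ≤ k, a (j + i) = a (j' + i)) →
      (∀ i ≤ k, l (j + i) = l (j' + i)) → j = j') :
    ¬∃ p p' d, 2 ≤ d ∧ p + d + 2 ≤ p' ∧ p' + d < runStart l (n + k) ∧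
      runWord a l p = runWord a l (p + d) ∧
      ∀ t ≤ d, runWord a l (p + t) = runWord a l (p' + t) := by
  rintro ⟨p, p', d, hd, hpp, hN, hW, h⟩
  have hm := runStart_strictMono hl
  have ha : ∀ j, a (j + 1) ≠ a j := fun j => hdist j 1 le_rfl hk
  obtain ⟨i, h1, h2⟩ := exists_run hl p
  obtain ⟨i', h1', h2'⟩ := exists_run hl p'
  have hWi : runWord a l p = a i := runWord_eq hl h1 h2
  have hWi' : runWord a l p' = a i' := runWord_eq hl h1' h2'
  have hii : a i = a i' := by
    have := h 0 (by omega)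
    rwa [add_zero, add_zero, hWi, hWi'] at this
  -- The factor outlasts run `i` because runs have length at most `2 ≤ d`. It outlasts the next `k`
  -- runs because their letters differ from its last letter `a i`.
  have hstart : ∀ t ≤ k, runStart l (i + t + 1) ≤ p + d := by
    intro t ht
    induction t with
    | zero =>
      have := runStart_succ l i
      have := hl2 i
      rw [add_zero]
      omega
    | succ t ih =>
      refine runStart_le_of_ne (a := a) hl (ih (by omega)) le_rfl ?_
      rw [← hW, hWi]
      exact (hdist i (t + 1) (by omega) ht).symm
  have hshift := runStart_add_eq hl ha h1 h2 h1' h2' h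
  have hlet : ∀ t, runStart l (i + t + 1) ≤ p + d → a (i + t + 1) = a (i' + t + 1) := by
    intro t ht
    have e := hshift t ht
    have hle : p ≤ runStart l (i + t + 1) := h2.le.trans (hm.monotone (by omega))
    have := h (runStart l (i + t + 1) - p) (by omega)
    rwa [show p + (runStart l (i + t + 1) - p) = runStart l (i + t + 1) by omega,
      show p' + (runStart l (i + t + 1) - p) = runStart l (i' + t + 1) by omega,
      runWord_runStart hl, runWord_runStart hl] at this
  have hlen : ∀ t, runStart l (i + t + 2) ≤ p + d → l (i + t + 1) = l (i' + t + 1) := by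
    intro t ht
    have e1 : runStart l (i + t + 2) = _ := runStart_succ l (i + t + 1)
    have e2 : runStart l (i' + t + 2) = _ := runStart_succ l (i' + t + 1)
    have e3 : runStart l (i' + t + 2) + p = runStart l (i + t + 2) + p' := hshift (t + 1) ht
    have e4 := hshift t (by omega)
    omega
  have hk1 := hstart k le_rfl
  have hk1' := hshift k hk1
  have hi' : i' + k + 1 < n + k := hm.lt_iff_lt.1 (by omega)
  have hne : i < i' := by
    by_contra hle
    have := hm.monotone (show i' + 1 ≤ i + k + 1 by omega)
    have := hm.monotone (show i' + 1 ≤ i + 1 by omega)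
    have := hstart 0 (by omega)
    rw [add_zero] at this
    omega
  have hlen' : ∀ t < k, l (i + t + 1) = l (i' + t + 1) := fun t ht => hlen t (hstart (t + 1) ht)
  have hlet' : ∀ t ≤ k, a (i + t + 1) = a (i' + t + 1) := fun t ht => hlet t (hstart t ht)
  -- On a return, the factor may end as run `i + k + 1` begins, and the length of run `i` is
  -- unknown: this is the case for `hret`. Otherwise run `i + k + 1` is also complete, and the
  -- window starting at run `i + 1` is fully visible.
  by_cases hr : a (i + k + 1) = a i
  · refine hne.ne (hret i i' (by omega) (by omega) (fun t ht => ?_) (fun t ht ht' => ?_) hr ?_)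
    · rcases t with _ | t
      · exact hii
      · exact hlet' t (by omega)
    · obtain ⟨t, rfl⟩ : ∃ s, t = s + 1 := ⟨t - 1, by omega⟩
      exact hlen' t (by omega)
    · rw [← hlet' k le_rfl, hr, hii]
  · have hk2 : runStart l (i + k + 2) ≤ p + d := by
      refine runStart_le_of_ne (a := a) hl hk1 le_rfl ?_
      rw [← hW, hWi]
      exact fun h => hr h.symm
    have hlk := hlen k hk2
    refine hne.ne (Nat.succ_injective (huniq (i + 1) (i' + 1) (by omega) (by omega)
      (fun t ht => ?_) (fun t ht => ?_)))
    · rw [add_right_comm i, add_right_comm i']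
      exact hlet' t ht
    · rw [add_right_comm i, add_right_comm i']
      rcases ht.lt_or_eq with ht | rfl
      · exact hlen' t ht
      · exact hlk

end Runs

/-! ### Lower bound: the avoiding word -/

namespace Window

variable {k : ℕ}

/-- The length of the first run of a window. -/
def headLength (e : Window k) : ℕ := if e.2 0 then 2 else 1

theorem snd_zero_eq {x y : Window k} (h : headLength x = headLength y) : x.2 0 = y.2 0 := by
  unfold headLength at h
  generalize x.2 0 = b at h ⊢
  generalize y.2 0 = c at h ⊢
  revert b c
  decide

theorem card_window (k : ℕ) : Fintype.card (Window k) = (k + 2).factorial * 2 ^ (k + 1) := by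
  rw [Fintype.card_prod, Fintype.card_perm]
  simp

/-- `flip` pairs windows with first runs of lengths 1 and 2. -/
theorem two_mul_sum_headLength (k : ℕ) :
    2 * ∑ e : Window k, headLength e = 3 * Fintype.card (Window k) := by
  have h : ∑ e : Window k, headLength (flip e) = ∑ e : Window k, headLength e :=
    Equiv.sum_comp (Function.Involutive.toPerm flip flip_flip) headLength
  have h2 : ∀ e : Window k, headLength (flip e) + headLength e = 3 := by
    intro e
    rcases he : e.2 0 <;> simp [headLength, flip, he]
  rw [two_mul]
  nth_rw 1 [← h]
  rw [← Finset.sum_add_distrib, Finset.sum_congr rfl fun e _ => h2 e]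
  simp [mul_comm]

theorem exists_avoiding_word (hk : 1 ≤ k) :
    ∃ (N : ℕ) (W : ℕ → Fin (k + 2)), 2 * N = 3 * Fintype.card (Window k) + 4 * k ∧
      ¬∃ p p' d, 2 ≤ d ∧ p + d + 2 ≤ p' ∧ p' + d < N ∧ W p = W (p + d) ∧
        ∀ t ≤ d, W (p + t) = W (p' + t) := by
  obtain ⟨τ, ht, hret, hcyc⟩ := exists_transitive_transition (E := Window k) tail
    (fun e => e.1 0) flip flip_flip flip_ne tail_flip (fun _ => rfl) (fun _ _ => eq_or_eq_flip)
    (rotate k) connected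
  set σ := rotate k * τ with hσ
  have hon : σ.IsCycleOn ((Finset.univ : Finset (Window k)) : Set (Window k)) :=
    ⟨by simp, fun x _ y _ => hcyc x y⟩
  -- The circuit starts with double runs only, so the `k` runs repeated at the end to complete the
  -- last windows add `2 * k` letters.
  let e₀ : Window k := (1, fun _ => true)
  let e : ℕ → Window k := fun j => (σ ^ j) e₀
  have hstep : ∀ j, e (j + 1) = rotate k (τ (e j)) := fun j => by
    simp only [e, pow_succ', Perm.mul_apply, hσ]
  set n := Fintype.card (Window k) with hn
  have hinj : ∀ j j', j < n → j' < n → e j = e j' → j = j' := by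
    intro j j' hj hj' h
    have := (hon.pow_apply_eq_pow_apply (Finset.mem_univ e₀)).1 h
    rw [Finset.card_univ] at this
    exact Nat.ModEq.eq_of_lt_of_lt this hj hj'
  have hper : ∀ j, e (n + j) = e j := by
    intro j
    have := hon.pow_card_apply (Finset.mem_univ e₀)
    rw [Finset.card_univ] at this
    simp only [e]
    rw [add_comm, pow_add, Perm.mul_apply, this]
  let a : ℕ → Fin (k + 2) := fun j => (e j).1 0
  let l : ℕ → ℕ := fun j => headLength (e j)
  have hfst : ∀ i (hi : i ≤ k) j, (e j).1 ⟨i, by omega⟩ = a (j + i) := by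
    intro i
    induction i with
    | zero => intro _ j; rfl
    | succ i ih =>
      intro hi j
      have h1 := ih (by omega) (j + 1)
      have h2 := congrFun (congrArg Prod.fst (ht (e j))) ⟨i, hi⟩
      simp only [tail] at h2
      rw [show j + (i + 1) = j + 1 + i by omega, ← h1, hstep, rotate_fst]
      refine h2.symm.trans (congrArg _ ?_)
      rw [Fin.ext_iff, Fin.val_add_one_of_lt]
      · simp
      · rw [Fin.lt_def]; simp; omega
  have hsnd : ∀ i (hi : i ≤ k) j, (e j).2 ⟨i, by omega⟩ = (e (j + i)).2 0 := by
    intro i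
    induction i with
    | zero => intro _ j; rfl
    | succ i ih =>
      intro hi j
      have h1 := ih (by omega) (j + 1)
      have h2 := congrFun (congrArg Prod.snd (ht (e j))) ⟨i, hi⟩
      simp only [tail] at h2
      rw [show j + (i + 1) = j + 1 + i by omega, ← h1, hstep, rotate_snd]
      refine h2.symm.trans (congrArg _ ?_)
      rw [Fin.ext_iff, Fin.val_add_one_of_lt]
      · simp
      · rw [Fin.lt_def]; simp; omega
  have hlbit : ∀ j j', l j = l j' → (e j).2 0 = (e j').2 0 := fun _ _ => snd_zero_eq
  have htail : ∀ j j', (∀ i ≤ k, a (j + i) = a (j' + i)) →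
      (∀ i, 1 ≤ i → i ≤ k → l (j + i) = l (j' + i)) → tail (e j) = tail (e j') := by
    intro j j' h1 h2
    refine Prod.ext (funext fun i => ?_) (funext fun i => ?_)
    · have := h1 (i + 1) (by omega)
      rw [← hfst _ (by omega), ← hfst _ (by omega)] at this
      exact this
    · have := hlbit _ _ (h2 (i + 1) (by omega) (by omega))
      rw [← hsnd _ (by omega), ← hsnd _ (by omega)] at this
      exact this
  -- The run appended after `e j` has the letter missing from `τ (e j)`, which is not the first
  -- letter of `τ (e j)`. A return to `a j` thus forces a colour change.
  have hreturn : ∀ j, a (j + k + 1) = a j → (τ (e j)).1 0 ≠ (e j).1 0 := by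
    intro j h h'
    rw [show j + k + 1 = j + 1 + k by omega, ← hfst k le_rfl, hstep, rotate_fst] at h
    have h3 : (e j).1 0 = a j := rfl
    rw [← h3, ← h', (τ (e j)).1.injective.eq_iff, Fin.ext_iff, Fin.val_add_one_of_lt] at h
    · simp at h
    · rw [Fin.lt_def]; simp
  refine ⟨runStart l (n + k), runWord a l, ?_, runWord_not_repeat hk ?_ ?_ ?_ ?_ ?_⟩
  · rw [runStart, Finset.sum_range_add]
    have h1 : ∑ j ∈ Finset.range n, l j = ∑ x : Window k, headLength x := by
      refine Finset.sum_bij (fun j _ => e j) (fun _ _ => Finset.mem_univ _)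
        (fun j hj j' hj' h => hinj j j' (Finset.mem_range.1 hj) (Finset.mem_range.1 hj') h)
        (fun x hx => ?_) fun _ _ => rfl
      obtain ⟨j, hj, h⟩ := hon.exists_pow_eq (Finset.mem_univ e₀) hx
      exact ⟨j, Finset.mem_range.2 hj, h⟩
    have h2 : ∑ j ∈ Finset.range k, l (n + j) = ∑ j ∈ Finset.range k, 2 := by
      refine Finset.sum_congr rfl fun j hj => ?_
      have := hsnd j (Finset.mem_range.1 hj).le 0
      simp only [l, hper, headLength]
      rw [zero_add] at this
      rw [← this]
      rfl
    rw [h1, h2, mul_add, two_mul_sum_headLength, Finset.sum_const, Finset.card_range, smul_eq_mul,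
      ← hn]
    ring
  · intro j
    simp only [l, headLength]
    split_ifs <;> omega
  · intro j
    simp only [l, headLength]
    split_ifs <;> omega
  · intro j i hi hi' h
    rw [← hfst i hi'] at h
    have := (e j).1.injective h
    rw [Fin.ext_iff] at this
    simp at this
    omega
  · intro j j' hj hj' h1 h2 hr hr'
    rcases eq_or_eq_flip (htail j j' h1 h2) (h1 0 (by omega)) with h | h
    · exact hinj j j' hj hj' h.symm
    · have r1 := hreturn j hr
      have r2 := hreturn j' hr'
      rw [h] at r2
      exact absurd ⟨r1, r2⟩ (hret (e j))
  · intro j j' hj hj' h1 h2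
    rcases eq_or_eq_flip (htail j j' h1 fun i _ => h2 i) (h1 0 (by omega)) with h | h
    · exact hinj j j' hj hj' h.symm
    · have := hlbit _ _ (h2 0 (by omega))
      rw [add_zero, add_zero, h] at this
      simp [flip] at this

end Window

theorem lt_f_three {q : ℕ} (hq : 3 ≤ q) :
    (3 / 4 : ℝ) * 2 ^ q * (q.factorial : ℝ) + 2 * (q : ℝ) - 4 < (f 3 q : ℝ) := by
  obtain ⟨k, rfl⟩ : ∃ k, q = k + 2 := ⟨q - 2, by omega⟩
  obtain ⟨N, W, hN, hW⟩ := Window.exists_avoiding_word (k := k) (by omega)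
  have hlt : N < f 3 (k + 2) := by
    by_contra hle
    have hmem := (isLeast_f_three (q := k + 2) (by omega)).1
    have hc := hmem ((List.range (f 3 (k + 2))).map W) (by simp)
    rw [contains_zimin_three_iff] at hc
    obtain ⟨p, p', d, h1, h2, h3, h⟩ := hc
    exact hW ⟨p, p', d, h1, h2, by omega, h⟩
  rw [Window.card_window] at hN
  have hN' : (2 : ℝ) * N = 3 * ((k + 2).factorial * 2 ^ (k + 1)) + 4 * k := by exact_mod_cast hN
  have hlt' : (N : ℝ) < f 3 (k + 2) := by exact_mod_cast hlt
  refine lt_of_eq_of_lt ?_ hlt'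
  push_cast
  rw [pow_succ (2 : ℝ) (k + 1)]
  linarith

end ZiminWord

theorem theorem3 :
    -- the number `f(3, q)` is well defined
    (∀ q : ℕ, 1 ≤ q → IsLeast (ZiminWord.forcingLengths 3 q) (ZiminWord.f 3 q)) ∧
    -- `f(3, q) = Θ(2^q q!)`
    Asymptotics.IsTheta Filter.atTop
      (fun q : ℕ => (ZiminWord.f 3 q : ℝ)) (fun q : ℕ => (2 : ℝ) ^ q * (q.factorial : ℝ)) ∧
    -- the upper bound
    (∀ q : ℕ, 3 < q →
      (ZiminWord.f 3 q : ℝ) < 3 * Real.exp (1 / 2) * 2 ^ q * (q.factorial : ℝ)) ∧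
    -- the lower bound
    (∀ q : ℕ, 5 ≤ q →
      (3 / 4 : ℝ) * 2 ^ q * (q.factorial : ℝ) + 2 * (q : ℝ) - 4 < (ZiminWord.f 3 q : ℝ)) := by
  refine ⟨fun q => ZiminWord.isLeast_f_three, ⟨?_, ?_⟩,
    fun q hq => ZiminWord.f_three_lt (by omega), fun q hq => ZiminWord.lt_f_three (by omega)⟩
  · refine Asymptotics.IsBigO.of_bound (3 * Real.exp (1 / 2)) ?_
    filter_upwards [Filter.eventually_ge_atTop 2] with q hq
    rw [Real.norm_of_nonneg (by positivity), Real.norm_of_nonneg (by positivity), ← mul_assoc]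
    exact (ZiminWord.f_three_lt hq).le
  · refine Asymptotics.IsBigO.of_bound (4 / 3) ?_
    filter_upwards [Filter.eventually_ge_atTop 3] with q hq
    rw [Real.norm_of_nonneg (by positivity), Real.norm_of_nonneg (by positivity)]
    have h := ZiminWord.lt_f_three hq
    have hq' : (3 : ℝ) ≤ q := by exact_mod_cast hq
    linarith
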